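/- Let $S$ be a finite semigroup whose $\mathcal J$-classes form a chain $J_\epsilon<\dots<J_k$ under the order $J_x\le J_y \iff S^1xS^1\subseteq S^1yS^1$. The depth of the class $J_i$, and of each of its elements, is $k-i+1$, i.e. the number of $\mathcal J$-classes that are greater than or equal to $J_i$. A presentation for $S$ consists of a finite alphabet $A$, a set $\mathcal R\subseteq A^+\times A^+$ of defining relations and an isomorphism $A^+/\mathcal R^\sharp\cong S$, where $\mathcal R^\sharp$ is the smallest congruence on the free semigroup $A^+$ that contains $\mathcal R$. The depth of a defining relation $u=v$ is the depth of the element of $S$ represented by $u$ (equivalently, by $v$); the depth of a presentation is the maximal depth of its defining relations; and the relational depth $\operatorname{dep}(S)$ is the minimal depth of a presentation for $S$. Let $\mathcal I_n$ be the symmetric inverse monoid of all partial bijections of $\{1,\dots,n\}$, and for $0\le m\le n$ let $I_m=\{\alpha\in\mathcal I_n : |\operatorname{im}\alpha|\le m\}$ be its ideal of all partial bijections of rank at most $m$. **Theorem.** $$\operatorname{dep}(I_m)=\begin{cases}3 & \text{if } m=n\ge 2,\\ n-m+1 & \text{if } n>m>\tfrac n2,\\ m+1 & \text{if } m\le \tfrac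 n2.\end{cases}$$ -/

import Mathlib

/-! ### Green's `J`-order of a semigroup and depths of `J`-classes -/

section GreenJ

/-- The principal two-sided ideal `S¹ x S¹` of `S` generated by `x`. (It is the same set whether
or not a new identity is adjoined to a semigroup that already has one.) -/
def principalIdeal {S : Type} [Semigroup S] (x : S) : Set S :=
  {z | ∃ a b : WithOne S, (z : WithOne S) = a * (x : WithOne S) * b}

/-- Green's relation `J`: `x J y` if and only if `S¹ x S¹ = S¹ y S¹`. -/
def greenJ (S : Type) [Semigroup S] : Setoid S :=
  Setoid.ker (principalIdeal (S := S))

/-- The `J`-classes of `S`. -/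
def JClass (S : Type) [Semigroup S] : Type :=
  Quotient (greenJ S)

namespace JClass

variable {S : Type} [Semigroup S]

/-- The `J`-class of an element. -/
def of (x : S) : JClass S :=
  Quotient.mk (greenJ S) x

/-- The principal ideal generated by any element of a `J`-class. -/
def ideal (J : JClass S) : Set S :=
  Quotient.lift (s := greenJ S) principalIdeal (fun _ _ h => h) J

theorem ideal_injective : Function.Injective (ideal (S := S)) := by
  intro J K
  induction J using Quotient.inductionOn with
  | _ x =>
    induction K using Quotient.inductionOn with
    | _ y => exact fun h => Quotient.sound (s := greenJ S) h

/-- The order of `J`-classes: `J_x ≤ J_y` if and only if `S¹ x S¹ ⊆ S¹ y S¹`. -/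
instance : PartialOrder (JClass S) :=
  PartialOrder.lift ideal ideal_injective

/-- The depth of a `J`-class: the number of `J`-classes that are greater than or equal to it. If
the `J`-classes of `S` form a chain `J_ε < ⋯ < J_k`, this is `k - i + 1` for the class `J_i`. -/
noncomputable def depth (J : JClass S) : ℕ∞ :=
  (Set.Ici J).encard

end JClass

/-- The depth of an element of `S` is the depth of its `J`-class. -/
noncomputable def elementDepth {S : Type} [Semigroup S] (s : S) : ℕ∞ :=
  (JClass.of s).depth

end GreenJ

/-! ### Semigroup presentations and relational depth -/

section Presentations

/-- A presentation `⟨A ∣ R⟩` for the semigroup `S`: a finite alphabet `A`, a set `R` of pairs of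
nonempty words over `A`, and an isomorphism `A⁺ / R♯ ≅ S`, where `R♯` is the smallest
congruence on the free semigroup `A⁺` that contains `R`. -/
structure SemigroupPresentation (S : Type) [Semigroup S] where
  /-- the alphabet -/
  alphabet : Type
  /-- the alphabet is finite -/
  finite_alphabet : Finite alphabet
  /-- the defining relations -/
  rels : Set (FreeSemigroup alphabet × FreeSemigroup alphabet)
  /-- the identification of the semigroup defined by the presentation with `S` -/
  iso : (conGen (fun u v : FreeSemigroup alphabet => (u, v) ∈ rels)).Quotient ≃* S

namespace SemigroupPresentation

variable {S : Type} [Semigroup S]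

/-- The element of `S` that is represented by a word. -/
def eval (P : SemigroupPresentation S) (w : FreeSemigroup P.alphabet) : S :=
  P.iso (w : (conGen (fun u v : FreeSemigroup P.alphabet => (u, v) ∈ P.rels)).Quotient)

/-- The depth of a word is the depth of the element represented by it. -/
noncomputable def wordDepth (P : SemigroupPresentation S) (w : FreeSemigroup P.alphabet) : ℕ∞ :=
  elementDepth (P.eval w)

/-- The depth of a presentation: the maximal depth of a defining relation `u = v`, which is the
common depth of `u` and of `v`. -/
noncomputable def depth (P : SemigroupPresentation S) : ℕ∞ :=
  ⨆ p ∈ P.rels, P.wordDepth p.1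

end SemigroupPresentation

/-- The relational depth of `S`: the minimal depth of a presentation for `S`. (Every nonempty
subset of `ℕ∞` has a least element, so the infimum is attained.) -/
noncomputable def relationalDepth (S : Type) [Semigroup S] : ℕ∞ :=
  ⨅ P : SemigroupPresentation S, P.depth

end Presentations

/-! ### The symmetric inverse monoid and its ideals -/

section SymmetricInverseMonoid

/-- The symmetric inverse monoid: all partial bijections of an `n`-element set. -/
def SymInvMonoid (n : ℕ) : Type :=
  Fin n ≃. Fin n

namespace SymInvMonoid

variable {n : ℕ}

/-- The product `α * β` is the composition "first `α`, then `β`". -/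
instance : Monoid (SymInvMonoid n) where
  mul α β := PEquiv.trans α β
  one := PEquiv.refl (Fin n)
  mul_assoc α β γ := PEquiv.trans_assoc α β γ
  one_mul α := PEquiv.refl_trans α
  mul_one α := PEquiv.trans_refl α

/-- The image of a partial bijection. -/
def image (α : SymInvMonoid n) : Set (Fin n) :=
  {y | ∃ x, y ∈ (show Fin n ≃. Fin n from α) x}

/-- The rank of a partial bijection is the size of its image. -/
noncomputable def rank (α : SymInvMonoid n) : ℕ :=
  α.image.ncard

theorem image_mul_subset (α β : SymInvMonoid n) : (α * β).image ⊆ β.image := by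
  rintro y ⟨x, hx⟩
  obtain ⟨z, -, hz⟩ := (PEquiv.mem_trans α β x y).1 hx
  exact ⟨z, hz⟩

theorem rank_mul_le (α β : SymInvMonoid n) : (α * β).rank ≤ β.rank :=
  Set.ncard_le_ncard (image_mul_subset α β) (Set.toFinite _)

end SymInvMonoid

/-- The ideal `I_m` of the symmetric inverse monoid, consisting of all partial bijections of rank
at most `m`, as a subsemigroup. -/
def rankIdeal (n m : ℕ) : Subsemigroup (SymInvMonoid n) where
  carrier := {α | α.rank ≤ m}
  mul_mem' := fun {α β} _ hβ => le_trans (SymInvMonoid.rank_mul_le α β) hβ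

end SymmetricInverseMonoid

/-!
An element of `I_m` of rank `s` has depth `m + 1 - s` (`elementDepth_rankIdeal`). Hence
`dep(I_m) = m + 1 - r`, where `r` is the largest rank such that the relations of rank at least `r`
suffice to define `I_m`. This rank is `n - 2` if `m = n`, and the truncated difference `2 * m - n`
if `m < n`. Throughout, a partial bijection is written as the restriction `restr A g` of a
permutation `g` to a set `A`, whose size is the rank.

*Upper bound.* Let `T` be the semigroup generated by the partial bijections of rank from `r` to `m`
subject to all relations of rank at least `r`, and `π` its homomorphism onto `I_m`. By descending
induction on `k < r`, the map `π` is injective at rank `k`. Above rank `k` there is a well-defined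
section `σ` of `π`, and every element of `T` of rank `k` is of the form `σ p * σ a`, where `p` and
`a` have rank greater than `k`. This product does not change when a factor `c` is moved from
`p * c` to `c * a`, provided that `p * c` and `c * a` have rank greater than `k`. It therefore
suffices to connect any two factorizations of a partial bijection of rank `k` by such moves
(`SymInvMonoid.BalancedAbove.eq_of_mul_eq`). The moves shrink both factors to rank `k + 1` and
make the second one idempotent. What then remains is a permutation extending the product, one
extra point of its domain and one extra point of its image, and these can be varied freely when at
least three points lie outside the domain. Shrinking may fail only when both factors have rank
`m`, but then their product has rank at least `2 * m - n > k`.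

*Lower bound.* Let `X ≠ Y` be subsets of the same size with `|X ∩ Y| = r`: for `m < n` they have
size `m` and meet in as few points as possible, and for `m = n` they have size `n - 1`. The
identities on `X` and on `Y` commute. If all relations of a presentation had rank greater than `r`,
then every word obtained from a product of words for the identities on `X` and on `Y`, in this
order, would still be a product of a word with domain `X` and a word with image `Y`
(`SplitsAt.replace`), because a subword with parts in both factors has rank `r` unless one of its
parts is a permutation. The product in the other order does not have such a factorization, as its
prefix for the identity on `Y` shows. For `m = 0` there are no such `X` and `Y`, but a presentation
of the trivial semigroup needs at least one relation.
-/

/-! ### Partial bijections as restrictions of permutations -/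

namespace SymInvMonoid

variable {n : ℕ}

/-- The restriction of the permutation `g` to the set `A`, as a partial bijection. -/
def restr (A : Finset (Fin n)) (g : Equiv.Perm (Fin n)) : SymInvMonoid n :=
  (PEquiv.ofSet (A : Set (Fin n))).trans g.toPEquiv

theorem mem_restr {A : Finset (Fin n)} {g : Equiv.Perm (Fin n)} {x y : Fin n} :
    y ∈ (show Fin n ≃. Fin n from restr A g) x ↔ x ∈ A ∧ g x = y := by
  refine (PEquiv.mem_trans _ _ x y).trans ⟨?_, ?_⟩
  · rintro ⟨z, hz, hy⟩
    obtain ⟨rfl, hx⟩ := PEquiv.mem_ofSet_iff.1 hz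
    exact ⟨hx, by simpa [Equiv.toPEquiv, eq_comm] using hy⟩
  · rintro ⟨hx, rfl⟩
    exact ⟨x, PEquiv.mem_ofSet_iff.2 ⟨rfl, hx⟩, by simp [Equiv.toPEquiv]⟩

theorem restr_eq_iff {A B : Finset (Fin n)} {g h : Equiv.Perm (Fin n)} :
    restr A g = restr B h ↔ A = B ∧ ∀ x ∈ A, g x = h x := by
  constructor
  · intro e
    have key : ∀ x y, (x ∈ A ∧ g x = y) ↔ (x ∈ B ∧ h x = y) := fun x y => by
      rw [← mem_restr, ← mem_restr, e]
    refine ⟨Finset.ext fun x => ⟨fun hx => ((key x _).1 ⟨hx, rfl⟩).1,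
      fun hx => ((key x _).2 ⟨hx, rfl⟩).1⟩, fun x hx => ((key x _).1 ⟨hx, rfl⟩).2.symm⟩
  · rintro ⟨rfl, e⟩
    refine PEquiv.ext fun x => Option.ext fun y => ?_
    refine mem_restr.trans (Iff.trans ?_ mem_restr.symm)
    exact and_congr_right fun hx => by rw [e x hx]

theorem restr_mul_restr (A B : Finset (Fin n)) (g h : Equiv.Perm (Fin n)) :
    restr A g * restr B h = restr (A.filter fun x => g x ∈ B) (g.trans h) := by
  refine PEquiv.ext fun x => Option.ext fun y => ?_
  refine (PEquiv.mem_trans _ _ x y).trans (Iff.trans ?_ mem_restr.symm)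
  constructor
  · rintro ⟨z, hz, hy⟩
    obtain ⟨hx, rfl⟩ := mem_restr.1 hz
    obtain ⟨hx', rfl⟩ := mem_restr.1 hy
    exact ⟨Finset.mem_filter.2 ⟨hx, hx'⟩, rfl⟩
  · rintro ⟨hx, rfl⟩
    obtain ⟨hx, hx'⟩ := Finset.mem_filter.1 hx
    exact ⟨g x, mem_restr.2 ⟨hx, rfl⟩, mem_restr.2 ⟨hx', rfl⟩⟩

theorem rank_restr (A : Finset (Fin n)) (g : Equiv.Perm (Fin n)) : (restr A g).rank = A.card := by
  have : (restr A g).image = g '' (A : Set (Fin n)) := by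
    ext y
    exact ⟨fun ⟨x, hx⟩ => ⟨x, mem_restr.1 hx⟩, fun ⟨x, hx⟩ => ⟨x, mem_restr.2 hx⟩⟩
  rw [rank, this, Set.ncard_image_of_injective _ g.injective, Set.ncard_coe_finset]

theorem restr_univ_one : restr Finset.univ 1 = (1 : SymInvMonoid n) := by
  refine PEquiv.ext fun x => Option.ext fun y => ?_
  refine mem_restr.trans ?_
  change _ ↔ y ∈ PEquiv.refl (Fin n) x
  simp [PEquiv.refl]

/-- A partial bijection of a finite set extends to a permutation. -/
theorem exists_eq_restr (α : SymInvMonoid n) : ∃ A g, α = restr A g := by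
  classical
  let f : Fin n ≃. Fin n := α
  let p : Fin n → Prop := fun x => (f x).isSome
  let φ : {x // p x} → Fin n := fun x => (f x).get x.2
  have hφ : ∀ x : {x // p x}, φ x ∈ f x := fun x => Option.get_mem x.2
  have inj : Function.Injective φ := fun x y h =>
    Subtype.ext (f.inj (hφ x) (h ▸ hφ y))
  let e : {x // p x} ≃ {y // y ∈ Set.range φ} := Equiv.ofInjective φ inj
  refine ⟨Finset.univ.filter p, e.extendSubtype, ?_⟩
  refine PEquiv.ext fun x => Option.ext fun y => ?_
  refine Iff.trans ?_ mem_restr.symm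
  change y ∈ f x ↔ _
  simp only [Finset.mem_filter, Finset.mem_univ, true_and]
  constructor
  · intro hy
    have hx : p x := Option.isSome_iff_exists.2 ⟨y, hy⟩
    refine ⟨hx, ?_⟩
    rw [Equiv.extendSubtype_apply_of_mem _ _ hx]
    exact Option.mem_unique (hφ ⟨x, hx⟩) hy
  · rintro ⟨hx, rfl⟩
    rw [Equiv.extendSubtype_apply_of_mem _ _ hx]
    exact hφ ⟨x, hx⟩

theorem rank_mul_le_left (α β : SymInvMonoid n) : (α * β).rank ≤ α.rank := by
  obtain ⟨A, g, rfl⟩ := exists_eq_restr α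
  obtain ⟨B, h, rfl⟩ := exists_eq_restr β
  rw [restr_mul_restr, rank_restr, rank_restr]
  exact Finset.card_filter_le _ _

/-- A partial bijection of rank at most that of `β` lies in the ideal generated by `β`; the
multipliers can be chosen of the same rank as `α`, and so within any `I_m` that contains `α`. -/
theorem exists_mul_mul_eq {α β : SymInvMonoid n} (h : α.rank ≤ β.rank) :
    ∃ γ δ : SymInvMonoid n, γ.rank = α.rank ∧ δ.rank = α.rank ∧ α = γ * β * δ := by
  obtain ⟨A, g, rfl⟩ := exists_eq_restr α
  obtain ⟨B, k, rfl⟩ := exists_eq_restr β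
  rw [rank_restr, rank_restr] at h
  obtain ⟨C, hCB, hC⟩ := Finset.exists_subset_card_eq h
  let e : {x // x ∈ A} ≃ {x // x ∈ C} := Finset.equivOfCardEq hC.symm
  have he : ∀ x ∈ A, e.extendSubtype x ∈ B := fun x hx => by
    rw [Equiv.extendSubtype_apply_of_mem _ _ hx]
    exact hCB (e ⟨x, hx⟩).2
  refine ⟨restr A e.extendSubtype, restr (A.image (e.extendSubtype.trans k))
    ((e.extendSubtype.trans k).symm.trans g), ?_, ?_, ?_⟩
  · rw [rank_restr, rank_restr]
  · rw [rank_restr, rank_restr, Finset.card_image_of_injective _ (Equiv.injective _)]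
  · rw [restr_mul_restr, restr_mul_restr, restr_eq_iff]
    constructor
    · ext x
      simp only [Finset.mem_filter, Finset.mem_image]
      exact ⟨fun hx => ⟨⟨hx, he x hx⟩, x, hx, rfl⟩, fun hx => hx.1.1⟩
    · intro x _
      simp

end SymInvMonoid

/-! ### Depths of the elements of `I_m` -/

section Depth

open SymInvMonoid

variable {n m : ℕ}

theorem mem_principalIdeal_rankIdeal {s z : rankIdeal n m} :
    z ∈ principalIdeal s ↔ z.1.rank ≤ s.1.rank := by
  constructor
  · rintro ⟨a, b, h⟩
    induction a using WithOne.recOneCoe with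
    | one =>
      induction b using WithOne.recOneCoe with
      | one =>
        rw [one_mul, mul_one, WithOne.coe_inj] at h
        rw [h]
      | coe b =>
        rw [one_mul, ← WithOne.coe_mul, WithOne.coe_inj] at h
        rw [h]
        exact rank_mul_le_left _ _
    | coe a =>
      induction b using WithOne.recOneCoe with
      | one =>
        rw [mul_one, ← WithOne.coe_mul, WithOne.coe_inj] at h
        rw [h]
        exact rank_mul_le _ _
      | coe b =>
        rw [← WithOne.coe_mul, ← WithOne.coe_mul, WithOne.coe_inj] at h
        rw [h]
        exact (rank_mul_le_left _ _).trans (rank_mul_le _ _)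
  · intro h
    obtain ⟨γ, δ, hγ, hδ, e⟩ := exists_mul_mul_eq h
    refine ⟨((⟨γ, hγ.trans_le z.2⟩ : rankIdeal n m) : WithOne (rankIdeal n m)),
      ((⟨δ, hδ.trans_le z.2⟩ : rankIdeal n m) : WithOne (rankIdeal n m)), ?_⟩
    rw [← WithOne.coe_mul, ← WithOne.coe_mul, WithOne.coe_inj]
    exact Subtype.ext e

theorem JClass.of_le_of_iff {s t : rankIdeal n m} :
    JClass.of s ≤ JClass.of t ↔ s.1.rank ≤ t.1.rank := by
  change principalIdeal s ⊆ principalIdeal t ↔ _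
  refine ⟨fun h => mem_principalIdeal_rankIdeal.1 (h (mem_principalIdeal_rankIdeal.2 le_rfl)),
    fun h z hz => mem_principalIdeal_rankIdeal.2 ((mem_principalIdeal_rankIdeal.1 hz).trans h)⟩

/-- The `J`-classes of `I_m` above that of `s` correspond to the ranks from `s.rank` to `m`. -/
theorem elementDepth_rankIdeal (hmn : m ≤ n) (s : rankIdeal n m) :
    elementDepth s = ((m + 1 - s.1.rank : ℕ) : ℕ∞) := by
  have hex : ∀ r : ℕ, ∃ t : rankIdeal n m, r ≤ m → t.1.rank = r := fun r => by
    by_cases hr : r ≤ m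
    · obtain ⟨A, -, hA⟩ := Finset.exists_subset_card_eq
        (s := (Finset.univ : Finset (Fin n))) (n := r) (by simpa using hr.trans hmn)
      have := rank_restr A 1
      exact ⟨⟨restr A 1, (this.trans hA).trans_le hr⟩, fun _ => this.trans hA⟩
    · exact ⟨s, fun h => absurd h hr⟩
  choose t ht using hex
  have himg : Set.Ici (JClass.of s) = (fun r => JClass.of (t r)) '' Set.Icc s.1.rank m := by
    ext J
    induction J using Quotient.inductionOn with
    | _ x =>
      constructor
      · intro hx
        have hx : s.1.rank ≤ x.1.rank := JClass.of_le_of_iff.1 hx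
        exact ⟨x.1.rank, ⟨hx, x.2⟩, le_antisymm (JClass.of_le_of_iff.2 (ht _ x.2).le)
          (JClass.of_le_of_iff.2 (ht _ x.2).ge)⟩
      · rintro ⟨r, hr, e⟩
        refine le_of_le_of_eq (b := JClass.of (t r)) ?_ e
        exact JClass.of_le_of_iff.2 (hr.1.trans (ht r hr.2).ge)
  have hinj : Set.InjOn (fun r => JClass.of (t r)) (Set.Icc s.1.rank m) := by
    intro r hr r' hr' e
    rw [← ht r hr.2, ← ht r' hr'.2]
    exact le_antisymm (JClass.of_le_of_iff.1 (le_of_eq e)) (JClass.of_le_of_iff.1 (ge_of_eq e))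
  rw [elementDepth, JClass.depth, himg, hinj.encard_image, ← Finset.coe_Icc,
    Set.encard_coe_eq_coe_finsetCard, Nat.card_Icc]

end Depth

/-! ### Maps that are balanced above a rank -/

namespace SymInvMonoid

variable {n : ℕ}

section Balanced

variable {X : Type*} (k m : ℕ) (F : SymInvMonoid n → SymInvMonoid n → X)

/-- A map of two variables is balanced above rank `k` if a factor `c` can be passed from the first
argument to the second one as long as all arguments that occur have rank greater than `k`
(and all factors have rank at most `m`). -/
def BalancedAbove : Prop :=
  ∀ p c a : SymInvMonoid n, p.rank ≤ m → c.rank ≤ m → a.rank ≤ m →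
    k < (p * c).rank → k < (c * a).rank → F (p * c) a = F p (c * a)

variable {k m F}

/-- If the domain `B` of the second argument is not too large, then the first argument can be
shrunk to rank `k + 1`: the identity on `B` and one more point of the image of the first argument
is absorbed by the second argument. -/
theorem BalancedAbove.restrict_left (hF : BalancedAbove k m F) {A B : Finset (Fin n)}
    {g h : Equiv.Perm (Fin n)} {x : Fin n} (hA : A.card ≤ m) (hB : B.card < m) (hkB : k < B.card)
    (hk : (A.filter fun z => g z ∈ B).card = k) (hx : x ∈ A) (hxB : g x ∉ B) :
    F (restr A g) (restr B h) =
      F (restr (insert x (A.filter fun z => g z ∈ B)) g) (restr B h) := by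
  have e1 : restr A g * restr (insert (g x) B) 1 =
      restr (insert x (A.filter fun z => g z ∈ B)) g := by
    rw [restr_mul_restr, restr_eq_iff]
    refine ⟨?_, fun _ _ => rfl⟩
    ext z
    simp only [Finset.mem_filter, Finset.mem_insert, g.injective.eq_iff]
    constructor
    · rintro ⟨h1, h2 | h2⟩ <;> tauto
    · rintro (rfl | h2) <;> tauto
  have e2 : restr (insert (g x) B) 1 * restr B h = restr B h := by
    rw [restr_mul_restr, restr_eq_iff]
    refine ⟨?_, fun _ _ => rfl⟩
    ext z
    rw [Finset.mem_filter, Equiv.Perm.one_apply, Finset.mem_insert]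
    tauto
  have := hF (restr A g) (restr (insert (g x) B) 1) (restr B h) (by rwa [rank_restr])
    (by rw [rank_restr, Finset.card_insert_of_notMem hxB]; exact hB)
    (by rw [rank_restr]; exact hB.le)
    (by rw [e1, rank_restr, Finset.card_insert_of_notMem (by simp [hxB])]; omega)
    (by rwa [e2, rank_restr])
  rw [e1, e2] at this
  exact this.symm

/-- The dual of `BalancedAbove.restrict_left`. -/
theorem BalancedAbove.restrict_right (hF : BalancedAbove k m F) {A B : Finset (Fin n)}
    {g h : Equiv.Perm (Fin n)} {y : Fin n} (hA : A.card < m) (hB : B.card ≤ m) (hkA : k < A.card)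
    (hk : (A.filter fun z => g z ∈ B).card = k) (hy : y ∈ B) (hyA : y ∉ A.image g) :
    F (restr A g) (restr B h) =
      F (restr A g) (restr (insert y ((A.filter fun z => g z ∈ B).image g)) h) := by
  have e1 : restr A g * restr (insert y (A.image g)) 1 = restr A g := by
    rw [restr_mul_restr, restr_eq_iff]
    refine ⟨?_, fun _ _ => rfl⟩
    ext z
    simp only [Finset.mem_filter, Finset.mem_insert, Finset.mem_image]
    exact ⟨fun hz => hz.1, fun hz => ⟨hz, Or.inr ⟨z, hz, rfl⟩⟩⟩
  have e2 : restr (insert y (A.image g)) 1 * restr B h =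
      restr (insert y ((A.filter fun z => g z ∈ B).image g)) h := by
    rw [restr_mul_restr, restr_eq_iff]
    refine ⟨?_, fun _ _ => rfl⟩
    ext z
    rw [Finset.mem_filter, Equiv.Perm.one_apply]
    simp only [Finset.mem_filter, Finset.mem_insert, Finset.mem_image]
    constructor
    · rintro ⟨rfl | ⟨w, hw, rfl⟩, h2⟩
      · exact Or.inl rfl
      · exact Or.inr ⟨w, ⟨hw, h2⟩, rfl⟩
    · rintro (rfl | ⟨w, hw, rfl⟩)
      · exact ⟨Or.inl rfl, hy⟩
      · exact ⟨Or.inr ⟨w, hw.1, rfl⟩, hw.2⟩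
  have hy' : y ∉ (A.filter fun z => g z ∈ B).image g := fun h' =>
    hyA (Finset.image_subset_image (Finset.filter_subset _ _) h')
  have := hF (restr A g) (restr (insert y (A.image g)) 1) (restr B h)
    (by rw [rank_restr]; exact hA.le)
    (by
      rw [rank_restr, Finset.card_insert_of_notMem hyA,
        Finset.card_image_of_injective _ g.injective]
      exact hA)
    (by rwa [rank_restr])
    (by rwa [e1, rank_restr])
    (by
      rw [e2, rank_restr, Finset.card_insert_of_notMem hy',
        Finset.card_image_of_injective _ g.injective]
      omega)
  rwa [e1, e2] at this

/-- When both arguments have rank `k + 1`, the second one can be turned into an idempotent. -/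
theorem BalancedAbove.eq_idempotent_right (hF : BalancedAbove k m F) {A B : Finset (Fin n)}
    {g h : Equiv.Perm (Fin n)} (hkm : k + 2 ≤ m) (hA : A.card = k + 1) (hB : B.card = k + 1)
    (hk : (A.filter fun z => g z ∈ B).card = k) :
    F (restr A g) (restr B h) = F (restr A (g.trans h)) (restr (B.image h) 1) := by
  have hcard : (A.image g ∪ B).card = k + 2 := by
    have h1 : A.image g ∩ B = (A.filter fun z => g z ∈ B).image g := by
      ext z
      simp only [Finset.mem_inter, Finset.mem_image, Finset.mem_filter]
      constructor
      · rintro ⟨⟨w, hw, rfl⟩, h2⟩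
        exact ⟨w, ⟨hw, h2⟩, rfl⟩
      · rintro ⟨w, hw, rfl⟩
        exact ⟨⟨w, hw.1, rfl⟩, hw.2⟩
    have h2 := Finset.card_union_add_card_inter (A.image g) B
    rw [h1, Finset.card_image_of_injective _ g.injective,
      Finset.card_image_of_injective _ g.injective] at h2
    omega
  have e1 : restr A g * restr (A.image g ∪ B) h = restr A (g.trans h) := by
    rw [restr_mul_restr, restr_eq_iff]
    refine ⟨?_, fun _ _ => rfl⟩
    ext z
    simp only [Finset.mem_filter, Finset.mem_union, Finset.mem_image]
    exact ⟨fun hz => hz.1, fun hz => ⟨hz, Or.inl ⟨z, hz, rfl⟩⟩⟩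
  have e2 : restr (A.image g ∪ B) h * restr (B.image h) 1 = restr B h := by
    rw [restr_mul_restr, restr_eq_iff]
    refine ⟨?_, fun _ _ => rfl⟩
    ext z
    simp only [Finset.mem_filter, Finset.mem_union, Finset.mem_image, h.injective.eq_iff]
    constructor
    · rintro ⟨-, w, hw, rfl⟩
      exact hw
    · exact fun hz => ⟨Or.inr hz, z, hz, rfl⟩
  have := hF (restr A g) (restr (A.image g ∪ B) h) (restr (B.image h) 1)
    (by rw [rank_restr]; omega) (by rw [rank_restr]; omega)
    (by rw [rank_restr, Finset.card_image_of_injective _ h.injective]; omega)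
    (by rw [e1, rank_restr]; omega) (by rw [e2, rank_restr]; omega)
  rw [e1, e2] at this
  exact this.symm

/-- If `F` is balanced, then `F p a` equals a value of `F` at a pair of arguments of rank `k + 1`,
the second of which is idempotent: the restriction of a permutation `g` that extends `p * a` to
the domain of `p * a` and one more point `x`, and the identity on the image of `p * a` and one
more point `y`. -/
theorem BalancedAbove.exists_reduced (hF : BalancedAbove k m F) (hkm : k + 2 ≤ m)
    (hk2 : k + n < 2 * m) {p a : SymInvMonoid n} (hp : k < p.rank) (hpm : p.rank ≤ m)
    (ha : k < a.rank) (ham : a.rank ≤ m) (hpa : (p * a).rank = k) :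
    ∃ (D : Finset (Fin n)) (g : Equiv.Perm (Fin n)) (x y : Fin n), p * a = restr D g ∧ x ∉ D ∧
      y ∉ D.image g ∧ y ≠ g x ∧
      F p a = F (restr (insert x D) g) (restr (insert y (D.image g)) 1) := by
  obtain ⟨A, g, rfl⟩ := exists_eq_restr p
  obtain ⟨B, h, rfl⟩ := exists_eq_restr a
  rw [restr_mul_restr, rank_restr] at hpa
  rw [rank_restr] at hp hpm ha ham
  set D := A.filter fun z => g z ∈ B with hD
  obtain ⟨x, hxA, hxD⟩ : ∃ x ∈ A, x ∉ D := Finset.exists_mem_notMem_of_card_lt_card (by omega)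
  have hxB : g x ∉ B := fun h' => hxD (Finset.mem_filter.2 ⟨hxA, h'⟩)
  have hDg : (D.image g).card = k := by rw [Finset.card_image_of_injective _ g.injective, hpa]
  obtain ⟨y, hyB, hyD⟩ : ∃ y ∈ B, y ∉ D.image g :=
    Finset.exists_mem_notMem_of_card_lt_card (by omega)
  have hyA : y ∉ A.image g := by
    intro h'
    obtain ⟨w, hw, rfl⟩ := Finset.mem_image.1 h'
    exact hyD (Finset.mem_image.2 ⟨w, Finset.mem_filter.2 ⟨hw, hyB⟩, rfl⟩)
  have hyx : y ≠ g x := fun h' => hxB (h' ▸ hyB)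
  have hcx : (insert x D).card = k + 1 := by rw [Finset.card_insert_of_notMem hxD, hpa]
  have hcy : (insert y (D.image g)).card = k + 1 := by
    rw [Finset.card_insert_of_notMem hyD, hDg]
  have hD1 : (insert x D).filter (fun z => g z ∈ B) = D := by
    ext z
    simp only [hD, Finset.mem_filter, Finset.mem_insert]
    constructor
    · rintro ⟨rfl | h1, h2⟩
      · exact absurd h2 hxB
      · exact h1
    · exact fun h1 => ⟨Or.inr h1, h1.2⟩
  have hD2 : A.filter (fun z => g z ∈ insert y (D.image g)) = D := by
    ext z
    simp only [Finset.mem_filter, Finset.mem_insert]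
    constructor
    · rintro ⟨h1, rfl | h2⟩
      · exact absurd (Finset.mem_image_of_mem _ h1) hyA
      · obtain ⟨w, hw, e⟩ := Finset.mem_image.1 h2
        rwa [← g.injective e]
    · exact fun h1 => ⟨(Finset.mem_filter.1 h1).1, Or.inr (Finset.mem_image_of_mem _ h1)⟩
  have hD3 : (insert x D).filter (fun z => g z ∈ insert y (D.image g)) = D := by
    ext z
    simp only [Finset.mem_filter, Finset.mem_insert]
    constructor
    · rintro ⟨rfl | h1, h2⟩
      · rcases h2 with h2 | h2
        · exact absurd h2.symm hyx
        · obtain ⟨w, hw, e⟩ := Finset.mem_image.1 h2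
          rwa [← g.injective e]
      · exact h1
    · exact fun h1 => ⟨Or.inr h1, Or.inr (Finset.mem_image_of_mem _ h1)⟩
  have hshrink : F (restr A g) (restr B h) =
      F (restr (insert x D) g) (restr (insert y (D.image g)) h) := by
    by_cases hBm : B.card < m
    · rw [hF.restrict_left hpm hBm ha hpa hxA hxB, ← hD,
        hF.restrict_right (by omega) ham (by omega) (by rw [hD1, hpa]) hyB, hD1]
      intro h'
      obtain ⟨w, hw, e⟩ := Finset.mem_image.1 h'
      rcases Finset.mem_insert.1 hw with rfl | hw
      · exact hyx e.symm
      · exact hyD (e ▸ Finset.mem_image_of_mem _ hw)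
    · -- two subsets of size `m` meet in at least `2 * m - n` points
      have hAm : A.card < m := by
        by_contra hAm
        have h1 := Finset.card_union_add_card_inter (A.image g) B
        have h2 : ((A.image g) ∪ B).card ≤ n := by simpa using ((A.image g) ∪ B).card_le_univ
        have h3 : A.image g ∩ B ⊆ D.image g := by
          intro z hz
          obtain ⟨h4, h5⟩ := Finset.mem_inter.1 hz
          obtain ⟨w, hw, rfl⟩ := Finset.mem_image.1 h4
          exact Finset.mem_image.2 ⟨w, Finset.mem_filter.2 ⟨hw, h5⟩, rfl⟩
        have h6 := Finset.card_le_card h3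
        rw [Finset.card_image_of_injective _ g.injective] at h1
        omega
      rw [hF.restrict_right hAm ham hp hpa hyB hyA, ← hD,
        hF.restrict_left hpm (by omega) (by omega) (by rw [hD2, hpa]) hxA, hD2]
      intro h'
      rcases Finset.mem_insert.1 h' with h' | h'
      · exact hyx h'.symm
      · obtain ⟨w, hw, e⟩ := Finset.mem_image.1 h'
        exact hxD (g.injective e ▸ hw)
  refine ⟨D, g.trans h, x, h y, restr_mul_restr _ _ _ _, hxD, ?_, ?_, ?_⟩
  · intro h'
    obtain ⟨w, hw, e⟩ := Finset.mem_image.1 h'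
    exact hyD (h.injective e ▸ Finset.mem_image_of_mem _ hw)
  · exact fun h' => hyx (h.injective h')
  · rw [hshrink, hF.eq_idempotent_right hkm hcx hcy (by rw [hD3, hpa]), Finset.image_insert,
      Finset.image_image]
    rfl

/-- The reduced values of a balanced map do not depend on the choices of the two extra points and
of the permutation. -/
theorem BalancedAbove.reduced_eq_reduced (hF : BalancedAbove k m F) (hkm : k + 2 ≤ m)
    (hkn : k + 3 ≤ n) {D : Finset (Fin n)} {g g' : Equiv.Perm (Fin n)} (hD : D.card = k)
    (hg : ∀ z ∈ D, g z = g' z) {x y x' y' : Fin n} (hx : x ∉ D) (hy : y ∉ D.image g)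
    (hyx : y ≠ g x) (hx' : x' ∉ D) (hy' : y' ∉ D.image g') (hyx' : y' ≠ g' x') :
    F (restr (insert x D) g) (restr (insert y (D.image g)) 1) =
      F (restr (insert x' D) g') (restr (insert y' (D.image g')) 1) := by
  have hcard (g : Equiv.Perm (Fin n)) : (D.image g).card = k := by
    rw [Finset.card_image_of_injective _ g.injective, hD]
  have himg {g : Equiv.Perm (Fin n)} {z : Fin n} : g z ∈ D.image g ↔ z ∈ D := by
    simp [Finset.mem_image]
  have avoid (E : Finset (Fin n)) (hE : E.card ≤ k) (u v : Fin n) :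
      ∃ w, w ∉ E ∧ w ≠ u ∧ w ≠ v := by
    obtain ⟨w, -, hw⟩ := Finset.exists_mem_notMem_of_card_lt_card
      (s := insert u (insert v E)) (t := Finset.univ) (by
        have h1 := Finset.card_insert_le u (insert v E)
        have h2 := Finset.card_insert_le v E
        rw [Finset.card_univ, Fintype.card_fin]
        omega)
    simp only [Finset.mem_insert, not_or] at hw
    exact ⟨w, hw.2.2, hw.1, hw.2.1⟩
  have change_y {g : Equiv.Perm (Fin n)} {x y z : Fin n} (hx : x ∉ D) (hy : y ∉ D.image g)
      (hyx : y ≠ g x) (hz : z ∉ D.image g) (hzx : z ≠ g x) :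
      F (restr (insert x D) g) (restr (insert y (D.image g)) 1) =
        F (restr (insert x D) g) (restr (insert z (D.image g)) 1) := by
    have hcx : (insert x D).card = k + 1 := by rw [Finset.card_insert_of_notMem hx, hD]
    have hB : (insert y (insert z (D.image g))).card ≤ m := by
      have h1 := Finset.card_insert_le y (insert z (D.image g))
      have h2 := Finset.card_insert_le z (D.image g)
      have := hcard g
      omega
    have hfil : (insert x D).filter (fun w => g w ∈ insert y (insert z (D.image g))) = D := by
      ext w
      simp only [Finset.mem_filter, Finset.mem_insert, himg]
      constructor
      · rintro ⟨rfl | h1, h2⟩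
        · rcases h2 with h2 | h2 | h2
          exacts [absurd h2.symm hyx, absurd h2.symm hzx, h2]
        · exact h1
      · tauto
    have hout {w : Fin n} (hw : w ∉ D.image g) (hwx : w ≠ g x) : w ∉ (insert x D).image g := by
      rw [Finset.image_insert, Finset.mem_insert]
      tauto
    have e1 := hF.restrict_right (h := 1) (by omega) hB (by omega) (by rw [hfil, hD])
      (Finset.mem_insert_self _ _) (hout hy hyx)
    have e2 := hF.restrict_right (h := 1) (by omega) hB (by omega) (by rw [hfil, hD])
      (Finset.mem_insert_of_mem (Finset.mem_insert_self _ _)) (hout hz hzx)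
    rw [hfil] at e1 e2
    exact e1.symm.trans e2
  have change_x {g : Equiv.Perm (Fin n)} {x y z : Fin n} (hx : x ∉ D) (hy : y ∉ D.image g)
      (hyx : y ≠ g x) (hz : z ∉ D) (hyz : y ≠ g z) :
      F (restr (insert x D) g) (restr (insert y (D.image g)) 1) =
        F (restr (insert z D) g) (restr (insert y (D.image g)) 1) := by
    have hB : (insert y (D.image g)).card = k + 1 := by
      rw [Finset.card_insert_of_notMem hy, hcard]
    have hA : (insert x (insert z D)).card ≤ m := by
      have h1 := Finset.card_insert_le x (insert z D)
      have h2 := Finset.card_insert_le z D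
      omega
    have hfil : (insert x (insert z D)).filter (fun w => g w ∈ insert y (D.image g)) = D := by
      ext w
      simp only [Finset.mem_filter, Finset.mem_insert, himg]
      constructor
      · rintro ⟨h1, h2 | h2⟩
        · rcases h1 with rfl | rfl | h1
          exacts [absurd h2.symm hyx, absurd h2.symm hyz, h1]
        · exact h2
      · tauto
    have hout {w : Fin n} (hw : w ∉ D) (hwx : y ≠ g w) : g w ∉ insert y (D.image g) := by
      rw [Finset.mem_insert, himg, not_or]
      exact ⟨hwx.symm, hw⟩
    have e1 := hF.restrict_left (h := 1) hA (by omega) (by omega) (by rw [hfil, hD])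
      (Finset.mem_insert_self _ _) (hout hx hyx)
    have e2 := hF.restrict_left (h := 1) hA (by omega) (by omega) (by rw [hfil, hD])
      (Finset.mem_insert_of_mem (Finset.mem_insert_self _ _)) (hout hz hyz)
    rw [hfil] at e1 e2
    exact e1.symm.trans e2
  have change_xy {g : Equiv.Perm (Fin n)} {x y x' y' : Fin n} (hx : x ∉ D) (hy : y ∉ D.image g)
      (hyx : y ≠ g x) (hx' : x' ∉ D) (hy' : y' ∉ D.image g) (hyx' : y' ≠ g x') :
      F (restr (insert x D) g) (restr (insert y (D.image g)) 1) =
        F (restr (insert x' D) g) (restr (insert y' (D.image g)) 1) := by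
    obtain ⟨w, hw, hwx, hwx'⟩ := avoid (D.image g) (hcard g).le (g x) (g x')
    rw [change_y hx hy hyx hw hwx, change_x hx hw hwx hx' hwx', change_y hx' hw hwx' hy' hyx']
  have change_g {g g' : Equiv.Perm (Fin n)} {x y x' y' : Fin n} (hx : x ∉ D)
      (hy : y ∉ D.image g) (hyx : y ≠ g x) (hx' : x' ∉ D) (hy' : y' ∉ D.image g')
      (hyx' : y' ≠ g' x') (hg : ∀ z ∈ D, g z = g' z) {u : Fin n} (hu : u ∉ D) (hgu : g u = g' u) :
      F (restr (insert x D) g) (restr (insert y (D.image g)) 1) =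
        F (restr (insert x' D) g') (restr (insert y' (D.image g')) 1) := by
    obtain ⟨w, hw, hwu, -⟩ := avoid (D.image g) (hcard g).le (g u) (g u)
    have hi : D.image g = D.image g' := Finset.image_congr hg
    have hr : restr (insert u D) g = restr (insert u D) g' := by
      rw [restr_eq_iff]
      refine ⟨rfl, fun z hz => ?_⟩
      rcases Finset.mem_insert.1 hz with rfl | hz
      exacts [hgu, hg z hz]
    rw [change_xy hx hy hyx hu hw hwu, hr, hi]
    exact change_xy hu (hi ▸ hw) (hgu ▸ hwu) hx' hy' hyx'
  -- a permutation that agrees with `g` on `D` and at `u`, and with `g'` on `D` and at `v`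
  obtain ⟨u, hu, -, -⟩ := avoid D hD.le x x
  obtain ⟨v, hv, hvu, hvg⟩ := avoid D hD.le u (g'.symm (g u))
  have hvg' : g' v ≠ g u := fun h' => hvg (by rw [← h', Equiv.symm_apply_apply])
  let f : Equiv.Perm (Fin n) := g.trans (Equiv.swap (g v) (g' v))
  have hfu : g u = f u :=
    (Equiv.swap_apply_of_ne_of_ne (fun h' => hvu (g.injective h').symm) hvg'.symm).symm
  have hfv : f v = g' v := Equiv.swap_apply_left _ _
  have hfD : ∀ z ∈ D, g z = f z := fun z hz => by
    refine (Equiv.swap_apply_of_ne_of_ne (fun h' => ?_) (fun h' => ?_)).symm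
    · exact hv (g.injective h' ▸ hz)
    · rw [hg z hz] at h'
      exact hv (g'.injective h' ▸ hz)
  obtain ⟨w, hw, hwu, -⟩ := avoid (D.image f) (hcard f).le (f u) (f u)
  rw [change_g hx hy hyx hu hw hwu hfD hu hfu]
  exact change_g hu hw hwu hx' hy' hyx' (fun z hz => (hfD z hz).symm.trans (hg z hz)) hv hfv

/-- In the range of `k` given by the hypotheses, a map that is balanced above rank `k` depends
only on the product of its arguments when that product has rank `k`. -/
theorem BalancedAbove.eq_of_mul_eq (hF : BalancedAbove k m F) (hkm : k + 2 ≤ m)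
    (hkn : k + 3 ≤ n) (hk2 : k + n < 2 * m) {p a p' a' : SymInvMonoid n} (hp : k < p.rank)
    (hpm : p.rank ≤ m) (ha : k < a.rank) (ham : a.rank ≤ m) (hp' : k < p'.rank)
    (hpm' : p'.rank ≤ m) (ha' : k < a'.rank) (ham' : a'.rank ≤ m) (hpa : (p * a).rank = k)
    (h : p * a = p' * a') : F p a = F p' a' := by
  obtain ⟨D, g, x, y, e, hx, hy, hyx, hv⟩ := hF.exists_reduced hkm hk2 hp hpm ha ham hpa
  obtain ⟨D', g', x', y', e', hx', hy', hyx', hv'⟩ :=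
    hF.exists_reduced hkm hk2 hp' hpm' ha' ham' (h ▸ hpa)
  obtain ⟨rfl, hg⟩ := restr_eq_iff.1 (e.symm.trans (h.trans e'))
  rw [hv, hv']
  refine hF.reduced_eq_reduced hkm hkn ?_ hg hx hy hyx hx' hy' hyx'
  rw [← hpa, e, rank_restr]

end Balanced

/-- A partial bijection of rank `k` is a product of two partial bijections of rank `k + 1`, where
the domain of the first one can be enlarged by any given point `x`. -/
theorem exists_mul_eq_restr {k : ℕ} (hkn : k + 2 ≤ n) {D : Finset (Fin n)}
    (g : Equiv.Perm (Fin n)) (hD : D.card = k) {x : Fin n} (hx : x ∉ D) :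
    ∃ a : SymInvMonoid n, a.rank = k + 1 ∧ restr (insert x D) g * a = restr D g := by
  obtain ⟨y, -, hy⟩ := Finset.exists_mem_notMem_of_card_lt_card
    (s := insert x D) (t := Finset.univ) (by
      rw [Finset.card_insert_of_notMem hx, Finset.card_univ, Fintype.card_fin]
      omega)
  have hy' := not_or.1 (fun h => hy (Finset.mem_insert.2 h))
  refine ⟨restr ((insert y D).image g) 1, ?_, ?_⟩
  · rw [rank_restr, Finset.card_image_of_injective _ g.injective,
      Finset.card_insert_of_notMem hy'.2, hD]
  · rw [restr_mul_restr, restr_eq_iff]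
    refine ⟨?_, fun _ _ => rfl⟩
    ext z
    simp only [Finset.mem_filter, Finset.mem_insert, Finset.mem_image, g.injective.eq_iff,
      exists_eq_right]
    constructor
    · rintro ⟨rfl | h1, rfl | h2⟩
      exacts [absurd rfl hy'.1, h2, h1, h1]
    · exact fun h1 => ⟨Or.inr h1, Or.inr h1⟩

end SymInvMonoid

/-! ### Descending induction on the rank -/

namespace SymInvMonoid

variable {n m r : ℕ} {T : Type*} [Semigroup T] {π : T →ₙ* SymInvMonoid n}

/-- A homomorphism whose image contains the partial bijections of rank between `r` and `m` has all
partial bijections of rank at most `m` in its image, because a partial bijection of rank `k < r`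
is a product of two partial bijections of rank `k + 1`. -/
theorem surjective_of_surjective_above (hr : ∀ k < r, k + 2 ≤ m ∧ k + 3 ≤ n)
    (h : ∀ s : SymInvMonoid n, r ≤ s.rank → s.rank ≤ m → ∃ t, π t = s) (s : SymInvMonoid n)
    (hs : s.rank ≤ m) : ∃ t, π t = s := by
  have key : ∀ j ≤ r, ∀ s : SymInvMonoid n, r ≤ s.rank + j → s.rank ≤ m → ∃ t, π t = s := by
    intro j
    induction j with
    | zero => exact fun _ => h
    | succ j ih =>
      intro hj s hs hsm
      by_cases hs' : r ≤ s.rank + j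
      · exact ih (by omega) s hs' hsm
      obtain ⟨D, g, rfl⟩ := exists_eq_restr s
      rw [rank_restr] at hs hs' hsm
      obtain ⟨h1, h2⟩ := hr D.card (by omega)
      obtain ⟨x, -, hx⟩ := Finset.exists_mem_notMem_of_card_lt_card
        (s := D) (t := Finset.univ) (by rw [Finset.card_univ, Fintype.card_fin]; omega)
      obtain ⟨a, ha, e⟩ := exists_mul_eq_restr (by omega) g rfl hx
      have hc := Finset.card_insert_of_notMem hx
      obtain ⟨t, ht⟩ := ih (by omega) (restr (insert x D) g) (by rw [rank_restr]; omega)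
        (by rw [rank_restr]; omega)
      obtain ⟨t', ht'⟩ := ih (by omega) a (by omega) (by omega)
      exact ⟨t * t', by rw [map_mul, ht, ht', e]⟩
  exact key r le_rfl s (by omega) hs

/-- Suppose that `T` is generated by elements whose images have rank at least `r > k`. If a
homomorphism from `T` onto `I_m` is injective above rank `k`, then it is injective at rank `k`:
the product of sections of `p` and `a` is balanced above rank `k`. -/
theorem injective_at_of_injective_above {k : ℕ} (hk : k < r) (hkm : k + 2 ≤ m) (hkn : k + 3 ≤ n)
    (hk2 : k + n < 2 * m) (hm : ∀ t, (π t).rank ≤ m)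
    (hgen : ∀ Q : T → Prop, (∀ t, r ≤ (π t).rank → Q t) →
      (∀ s t, r ≤ (π s).rank → Q t → Q (s * t)) → ∀ t, Q t)
    (hsurj : ∀ s : SymInvMonoid n, s.rank ≤ m → ∃ t, π t = s)
    (hinj : ∀ t t', k < (π t).rank → π t = π t' → t = t')
    {t t' : T} (ht : (π t).rank = k) (htt' : π t = π t') : t = t' := by
  have : ∀ s : SymInvMonoid n, ∃ t, s.rank ≤ m → π t = s := fun s => by
    by_cases hs : s.rank ≤ m
    · obtain ⟨t, ht⟩ := hsurj s hs
      exact ⟨t, fun _ => ht⟩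
    · exact ⟨t, fun h => absurd h hs⟩
  choose σ hσ using this
  have σ_mul (p a : SymInvMonoid n) (hp : p.rank ≤ m) (ha : a.rank ≤ m)
      (hpa : k < (p * a).rank) : σ (p * a) = σ p * σ a := by
    have e := hσ (p * a) ((rank_mul_le p a).trans ha)
    refine hinj _ _ (by rwa [e]) ?_
    rw [e, map_mul, hσ p hp, hσ a ha]
  have σ_π (t : T) (ht : k < (π t).rank) : t = σ (π t) := hinj _ _ ht (hσ _ (hm t)).symm
  have hF : BalancedAbove k m fun p a => σ p * σ a := by
    intro p c a hp hc ha h1 h2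
    simp only
    rw [σ_mul p c hp hc h1, σ_mul c a hc ha h2, mul_assoc]
  have key : ∀ t : T, (π t).rank = k → ∃ p a : SymInvMonoid n, k < p.rank ∧ p.rank ≤ m ∧
      k < a.rank ∧ a.rank ≤ m ∧ t = σ p * σ a := by
    refine hgen _ (fun t h1 h2 => absurd h1 (by omega)) ?_
    intro s t hs ih hst
    rw [map_mul] at hst
    have hs' : k < (π s).rank := hk.trans_le hs
    by_cases ht : k < (π t).rank
    · exact ⟨π s, π t, hs', hm s, ht, hm t, by rw [← σ_π s hs', ← σ_π t ht]⟩
    have ht : (π t).rank = k := le_antisymm (not_lt.1 ht) (hst ▸ rank_mul_le _ _)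
    obtain ⟨p, a, hp, hpm, ha, ham, rfl⟩ := ih ht
    rw [map_mul, hσ p hpm, hσ a ham] at ht hst
    obtain ⟨A, h, hA⟩ := exists_eq_restr (π s)
    obtain ⟨D, g, hD⟩ := exists_eq_restr (p * a)
    have hDk : D.card = k := by rw [← ht, hD, rank_restr]
    rw [hA, hD, restr_mul_restr, rank_restr] at hst
    rw [hA, rank_restr] at hs'
    -- the factor `p` can be chosen so that the product `π s * p` has rank greater than `k`
    obtain ⟨w, hw, hwD⟩ : ∃ w ∈ A, w ∉ A.filter fun z => h z ∈ D :=
      Finset.exists_mem_notMem_of_card_lt_card (by omega)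
    have hwD' : h w ∉ D := fun h' => hwD (Finset.mem_filter.2 ⟨hw, h'⟩)
    obtain ⟨a', ha', e⟩ := exists_mul_eq_restr (by omega) g hDk hwD'
    have hp' : (restr (insert (h w) D) g).rank = k + 1 := by
      rw [rank_restr, Finset.card_insert_of_notMem hwD', hDk]
    have hsp : k < (π s * restr (insert (h w) D) g).rank := by
      rw [hA, restr_mul_restr, rank_restr, ← hst]
      refine Finset.card_lt_card ⟨fun z hz => ?_, fun hsub => hwD (hsub ?_)⟩
      · obtain ⟨h1, h2⟩ := Finset.mem_filter.1 hz
        exact Finset.mem_filter.2 ⟨h1, Finset.mem_insert_of_mem h2⟩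
      · exact Finset.mem_filter.2 ⟨hw, Finset.mem_insert_self _ _⟩
    refine ⟨π s * restr (insert (h w) D) g, a', hsp, (rank_mul_le _ _).trans (by omega),
      by omega, by omega, ?_⟩
    have := hF.eq_of_mul_eq hkm hkn hk2 hp hpm ha ham (by omega) (by omega) (by omega) (by omega)
      ht (hD.trans e.symm)
    rw [this, σ_mul _ _ (hm s) (by omega) hsp, ← σ_π s (hk.trans_le hs), mul_assoc]
  obtain ⟨p, a, hp, hpm, ha, ham, e⟩ := key t ht
  obtain ⟨p', a', hp', hpm', ha', ham', e'⟩ := key t' (htt' ▸ ht)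
  have h1 : π t = p * a := by rw [e, map_mul, hσ p hpm, hσ a ham]
  have h2 : π t' = p' * a' := by rw [e', map_mul, hσ p' hpm', hσ a' ham']
  rw [e, e']
  exact hF.eq_of_mul_eq hkm hkn hk2 hp hpm ha ham hp' hpm' ha' ham' (h1 ▸ ht)
    (h1.symm.trans (htt'.trans h2))

/-- If `T` is generated by elements whose images have rank at least `r`, then, for `r` in the
given range, a homomorphism from `T` onto `I_m` is injective as soon as it is injective at the
ranks at least `r`. -/
theorem injective_of_injective_above (hr : ∀ k < r, k + 2 ≤ m ∧ k + 3 ≤ n ∧ k + n < 2 * m)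
    (hm : ∀ t, (π t).rank ≤ m)
    (hgen : ∀ Q : T → Prop, (∀ t, r ≤ (π t).rank → Q t) →
      (∀ s t, r ≤ (π s).rank → Q t → Q (s * t)) → ∀ t, Q t)
    (hsurj : ∀ s : SymInvMonoid n, s.rank ≤ m → ∃ t, π t = s)
    (hinj : ∀ t t', r ≤ (π t).rank → π t = π t' → t = t') : Function.Injective π := by
  have key : ∀ j ≤ r, ∀ t t', r ≤ (π t).rank + j → π t = π t' → t = t' := by
    intro j
    induction j with
    | zero => exact fun _ => hinj
    | succ j ih =>
      intro hj t t' ht e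
      by_cases ht' : r ≤ (π t).rank + j
      · exact ih (by omega) t t' ht' e
      obtain ⟨h1, h2, h3⟩ := hr (π t).rank (by omega)
      exact injective_at_of_injective_above (by omega) h1 h2 h3 hm hgen hsurj
        (fun s s' hs => ih (by omega) s s' (by omega)) rfl e
  exact fun t t' => key r le_rfl t t' (by omega)

end SymInvMonoid

/-! ### A presentation of small depth -/

section UpperBound

open SymInvMonoid

variable (n m r : ℕ)

/-- The partial bijections of rank between `r` and `m`. -/
abbrev TopElement : Type :=
  {s : rankIdeal n m // r ≤ s.1.rank}

/-- The value of a word in partial bijections of rank between `r` and `m`. -/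
def topEval : FreeSemigroup (TopElement n m r) →ₙ* rankIdeal n m :=
  FreeSemigroup.lift Subtype.val

/-- All relations between words in partial bijections of rank between `r` and `m` whose value has
rank at least `r`. -/
def topRels : Set (FreeSemigroup (TopElement n m r) × FreeSemigroup (TopElement n m r)) :=
  {p | topEval n m r p.1 = topEval n m r p.2 ∧ r ≤ (topEval n m r p.1).1.rank}

/-- The congruence generated by `topRels`. -/
abbrev topCon : Con (FreeSemigroup (TopElement n m r)) :=
  conGen fun u v => (u, v) ∈ topRels n m r

theorem topCon_le : topCon n m r ≤ Con.ker (topEval n m r) :=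
  Con.conGen_le.2 fun _ _ h => h.1

/-- The evaluation of words, on the semigroup defined by the relations `topRels`. -/
def topHom : (topCon n m r).Quotient →ₙ* rankIdeal n m where
  toFun := Quotient.lift (topEval n m r) fun _ _ h => topCon_le n m r h
  map_mul' x y := by
    induction x, y using Con.induction_on₂ with
    | _ u v => exact map_mul (topEval n m r) u v

theorem topHom_bijective (hr : ∀ k < r, k + 2 ≤ m ∧ k + 3 ≤ n ∧ k + n < 2 * m) :
    Function.Bijective (topHom n m r) := by
  let incl : rankIdeal n m →ₙ* SymInvMonoid n := MulMemClass.subtype (rankIdeal n m)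
  let π : (topCon n m r).Quotient →ₙ* SymInvMonoid n := incl.comp (topHom n m r)
  have hπ (u : FreeSemigroup (TopElement n m r)) :
      π (u : (topCon n m r).Quotient) = (topEval n m r u).1 := rfl
  have hm (t) : (π t).rank ≤ m := (topHom n m r t).2
  have hof (a : TopElement n m r) : topEval n m r (FreeSemigroup.of a) = a.1 :=
    FreeSemigroup.lift_of _ _
  have hsurj (s : SymInvMonoid n) (hs : s.rank ≤ m) : ∃ t, π t = s := by
    refine surjective_of_surjective_above (fun k hk => ⟨(hr k hk).1, (hr k hk).2.1⟩)
      (fun s h1 h2 => ?_) s hs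
    exact ⟨(FreeSemigroup.of (⟨⟨s, h2⟩, h1⟩ : TopElement n m r) :
      FreeSemigroup (TopElement n m r)), by rw [hπ, hof]⟩
  have hinj : Function.Injective π := by
    refine injective_of_injective_above (r := r) (m := m) hr hm ?_ hsurj ?_
    · intro Q h1 h2 t
      induction t using Con.induction_on with
      | _ u =>
        induction u using FreeSemigroup.recOnMul with
        | ih1 a => exact h1 _ (by rw [hπ, hof]; exact a.2)
        | ih2 a u _ ih =>
          exact h2 (FreeSemigroup.of a : FreeSemigroup (TopElement n m r)) u
            (by rw [hπ, hof]; exact a.2) ih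
    · intro t t' ht e
      induction t, t' using Con.induction_on₂ with
      | _ u v =>
        exact (Con.eq _).2 (ConGen.Rel.of _ _ ⟨Subtype.ext e, ht⟩)
  refine ⟨fun t t' h => hinj (congrArg Subtype.val h), fun s => ?_⟩
  obtain ⟨t, ht⟩ := hsurj s.1 s.2
  exact ⟨t, Subtype.ext ht⟩

/-- The presentation of `I_m` whose relations are all those of rank at least `r`. -/
noncomputable def topPresentation (hr : ∀ k < r, k + 2 ≤ m ∧ k + 3 ≤ n ∧ k + n < 2 * m) :
    SemigroupPresentation (rankIdeal n m) where
  alphabet := TopElement n m r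
  finite_alphabet := by
    have : Finite (SymInvMonoid n) :=
      Finite.of_injective (β := Fin n → Option (Fin n)) PEquiv.toFun
        (DFunLike.coe_injective (F := Fin n ≃. Fin n))
    exact inferInstance
  rels := topRels n m r
  iso := MulEquiv.ofBijective (topHom n m r) (topHom_bijective n m r hr)

theorem relationalDepth_rankIdeal_le (hmn : m ≤ n)
    (hr : ∀ k < r, k + 2 ≤ m ∧ k + 3 ≤ n ∧ k + n < 2 * m) :
    relationalDepth (rankIdeal n m) ≤ ((m + 1 - r : ℕ) : ℕ∞) := by
  refine (iInf_le _ (topPresentation n m r hr)).trans (iSup₂_le fun p hp => ?_)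
  change elementDepth (topEval n m r p.1) ≤ _
  rw [elementDepth_rankIdeal hmn]
  exact Nat.cast_le.2 (Nat.sub_le_sub_left hp.2 _)

end UpperBound

/-! ### Words over an arbitrary presentation and the lower bound -/

section LowerBound

namespace SemigroupPresentation

variable {S : Type} [Semigroup S]

/-- The letters of a nonempty word. -/
def letters {A : Type*} (w : FreeSemigroup A) : List A :=
  w.head :: w.tail

theorem letters_mul {A : Type*} (u v : FreeSemigroup A) :
    letters (u * v) = letters u ++ letters v := by
  simp [letters, FreeSemigroup.head_mul, FreeSemigroup.tail_mul]

/-- A property of words that is preserved when a defining relation is applied to a subword holds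
for both or for neither of two words that represent the same element. -/
theorem iff_of_eval_eq (P : SemigroupPresentation S) (Q : List P.alphabet → Prop)
    (h : ∀ p ∈ P.rels, ∀ x y : List P.alphabet,
      Q (x ++ letters p.1 ++ y) ↔ Q (x ++ letters p.2 ++ y))
    {u v : FreeSemigroup P.alphabet} (e : P.eval u = P.eval v) :
    Q (letters u) ↔ Q (letters v) := by
  let c : Con (FreeSemigroup P.alphabet) :=
    { r := fun u v => ∀ x y : List P.alphabet, Q (x ++ letters u ++ y) ↔ Q (x ++ letters v ++ y)
      iseqv := ⟨fun _ _ _ => Iff.rfl, fun h x y => (h x y).symm,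
        fun h h' x y => (h x y).trans (h' x y)⟩
      mul' := fun {a b c d} h h' x y => by
        have h1 := h x (letters c ++ y)
        have h2 := h' (x ++ letters b) y
        simp only [letters_mul, List.append_assoc] at h1 h2 ⊢
        exact h1.trans h2 }
  have hle : conGen (fun u v => (u, v) ∈ P.rels) ≤ c := Con.conGen_le.2 fun u v huv => h _ huv
  have := hle ((Con.eq _).1 (P.iso.injective e)) [] []
  simpa using this

theorem eval_surjective (P : SemigroupPresentation S) : Function.Surjective P.eval := fun s => by
  obtain ⟨t, rfl⟩ := P.iso.surjective s
  induction t using Con.induction_on with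
  | _ u => exact ⟨u, rfl⟩

theorem eval_mul (P : SemigroupPresentation S) (u v : FreeSemigroup P.alphabet) :
    P.eval (u * v) = P.eval u * P.eval v := by
  rw [eval, Con.coe_mul, map_mul]
  rfl

theorem eval_eq_of_mem_rels (P : SemigroupPresentation S)
    {p : FreeSemigroup P.alphabet × FreeSemigroup P.alphabet} (hp : p ∈ P.rels) :
    P.eval p.1 = P.eval p.2 :=
  congrArg P.iso ((Con.eq _).2 (ConGen.Rel.of _ _ hp))

end SemigroupPresentation

open SymInvMonoid SemigroupPresentation

variable {n m : ℕ}

namespace SemigroupPresentation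

/-- The partial bijection represented by a possibly empty word. -/
def listEval (P : SemigroupPresentation (rankIdeal n m)) (w : List P.alphabet) : SymInvMonoid n :=
  (w.map fun a => (P.eval (FreeSemigroup.of a)).1).prod

theorem listEval_append (P : SemigroupPresentation (rankIdeal n m)) (u v : List P.alphabet) :
    P.listEval (u ++ v) = P.listEval u * P.listEval v := by
  simp [listEval]

theorem listEval_letters (P : SemigroupPresentation (rankIdeal n m))
    (w : FreeSemigroup P.alphabet) : P.listEval (letters w) = (P.eval w).1 := by
  induction w using FreeSemigroup.recOnMul with
  | ih1 a => exact mul_one _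
  | ih2 a w _ ih =>
    rw [letters_mul, listEval_append, ih, eval_mul]
    exact congrArg (· * _) (mul_one _)

theorem rank_listEval_le (P : SemigroupPresentation (rankIdeal n m)) {w : List P.alphabet}
    (hw : w ≠ []) : (P.listEval w).rank ≤ m := by
  obtain ⟨a, w, rfl⟩ := List.exists_cons_of_ne_nil hw
  have : P.listEval (a :: w) = (P.eval ⟨a, w⟩).1 := P.listEval_letters ⟨a, w⟩
  rw [this]
  exact (P.eval ⟨a, w⟩).2

end SemigroupPresentation

/-- A product that has the same rank as its second factor has the same image as that factor. -/
theorem image_eq_of_mul_eq_restr {A X B : Finset (Fin n)} {g h k : Equiv.Perm (Fin n)}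
    (hc : B.card = X.card) (e : restr A k * restr B h = restr X g) : X.image g = B.image h := by
  rw [restr_mul_restr, restr_eq_iff] at e
  refine Finset.eq_of_subset_of_card_le ?_ ?_
  · intro y hy
    obtain ⟨x, hx, rfl⟩ := Finset.mem_image.1 hy
    rw [← e.1] at hx
    rw [← e.2 x hx]
    exact Finset.mem_image_of_mem h (Finset.mem_filter.1 hx).2
  · rw [Finset.card_image_of_injective _ h.injective, Finset.card_image_of_injective _ g.injective,
      hc]

theorem domain_subset_of_mul_eq {X Y : Finset (Fin n)} {g h : Equiv.Perm (Fin n)}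
    {β : SymInvMonoid n} (e : restr X g * β = restr Y h) : Y ⊆ X := by
  obtain ⟨B, k, rfl⟩ := exists_eq_restr β
  rw [restr_mul_restr, restr_eq_iff] at e
  rw [← e.1]
  exact Finset.filter_subset _ _

/-- The product of a partial bijection with image `g(X)` and one with domain `g(Y)` has rank
`|X ∩ Y|`. -/
theorem rank_mul_of_factors {X Y : Finset (Fin n)} {g : Equiv.Perm (Fin n)}
    {x α β y : SymInvMonoid n} (hX : x * α = restr X g) (hα : α.rank = X.card)
    (hY : β * y = restr (Y.image g) g.symm) (hβ : β.rank = Y.card) :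
    (α * β).rank = (X ∩ Y).card := by
  obtain ⟨A, h, rfl⟩ := exists_eq_restr α
  obtain ⟨B, k, rfl⟩ := exists_eq_restr β
  obtain ⟨C, l, rfl⟩ := exists_eq_restr x
  rw [rank_restr] at hα hβ
  have h1 := image_eq_of_mul_eq_restr hα hX
  have h2 : Y.image g = B := Finset.eq_of_subset_of_card_le (domain_subset_of_mul_eq hY)
    (by rw [Finset.card_image_of_injective _ g.injective, hβ])
  have h3 : (A.filter fun z => h z ∈ B).image h = (X ∩ Y).image g := by
    rw [Finset.image_inter _ _ g.injective, h1, h2]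
    ext z
    simp only [Finset.mem_image, Finset.mem_filter, Finset.mem_inter]
    constructor
    · rintro ⟨w, hw, rfl⟩
      exact ⟨⟨w, hw.1, rfl⟩, hw.2⟩
    · rintro ⟨⟨w, hw, rfl⟩, h'⟩
      exact ⟨w, ⟨hw, h'⟩, rfl⟩
  rw [restr_mul_restr, rank_restr, ← Finset.card_image_of_injective _ h.injective, h3,
    Finset.card_image_of_injective _ g.injective]

theorem exists_perm_of_rank_eq {α : SymInvMonoid n} (h : α.rank = n) :
    ∃ g, α = restr Finset.univ g := by
  obtain ⟨A, g, rfl⟩ := exists_eq_restr α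
  rw [rank_restr] at h
  exact ⟨g, by rw [(Finset.card_eq_iff_eq_univ A).1 (by rw [h, Fintype.card_fin])]⟩

/-- The word `w` is a product of two words, the first of which represents a bijection with
domain `X` and the second one a bijection with image `Y`, such that the value of `w` is the
identity on `X ∩ Y`. -/
def SplitsAt (P : SemigroupPresentation (rankIdeal n m)) (X Y : Finset (Fin n))
    (w : List P.alphabet) : Prop :=
  ∃ (u v : List P.alphabet) (g : Equiv.Perm (Fin n)), w = u ++ v ∧
    P.listEval u = restr X g ∧ P.listEval v = restr (Y.image g) g.symm

/-- Splittings survive the application of a relation of rank greater than `|X ∩ Y|`. By the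
hypothesis `hs`, an element of `I_m` of rank at least `s` has rank `s` or is a permutation. -/
theorem SplitsAt.replace {P : SemigroupPresentation (rankIdeal n m)} {X Y : Finset (Fin n)}
    {s : ℕ} (hX : X.card = s) (hY : Y.card = s) (hs : ∀ r, s ≤ r → r ≤ m → r = s ∨ r = n)
    {p q : FreeSemigroup P.alphabet} (hp : (X ∩ Y).card < (P.eval p).1.rank)
    (hpq : P.eval p = P.eval q) {x y : List P.alphabet}
    (h : SplitsAt P X Y (x ++ letters p ++ y)) : SplitsAt P X Y (x ++ letters q ++ y) := by
  obtain ⟨u, v, g, e, hu, hv⟩ := h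
  have hev : P.listEval (letters p) = P.listEval (letters q) := by
    rw [listEval_letters, listEval_letters, hpq]
  rw [List.append_assoc, List.append_eq_append_iff] at e
  obtain ⟨z, rfl, e⟩ | ⟨z, rfl, rfl⟩ := e
  · rw [List.append_eq_append_iff] at e
    obtain ⟨z', rfl, rfl⟩ | ⟨z', e, rfl⟩ := e
    · -- the relation is applied inside the first factor
      refine ⟨x ++ (letters q ++ z'), v, g, by simp, ?_, hv⟩
      simpa only [listEval_append, hev] using hu
    · -- the relation is applied across the border `p = z z'` of the two factors
      rw [listEval_append] at hu hv
      by_cases hz : z = []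
      · subst hz
        refine ⟨x, letters q ++ y, g, by simp, ?_, ?_⟩
        · rw [← hu]
          simp [listEval]
        · rw [listEval_append, ← hev, e]
          simpa using hv
      by_cases hz' : z' = []
      · subst hz'
        refine ⟨x ++ letters q, y, g, by simp, ?_, ?_⟩
        · rw [listEval_append, ← hev, e]
          simpa using hu
        · rw [← hv]
          simp [listEval]
      have rz : (P.listEval z).rank = s ∨ (P.listEval z).rank = n := by
        refine hs _ ?_ (P.rank_listEval_le hz)
        rw [← hX, ← rank_restr X g, ← hu]
        exact rank_mul_le _ _
      have rz' : (P.listEval z').rank = s ∨ (P.listEval z').rank = n := by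
        refine hs _ ?_ (P.rank_listEval_le hz')
        rw [← hY, ← Finset.card_image_of_injective Y g.injective, ← rank_restr _ g.symm, ← hv]
        exact rank_mul_le_left _ _
      have hq : P.listEval (letters q) = P.listEval z * P.listEval z' := by
        rw [← hev, e, listEval_append]
      rcases rz with rz | rz
      · rcases rz' with rz' | rz'
        · -- the word `p` would have rank `|X ∩ Y|`
          have := rank_mul_of_factors hu (rz.trans hX.symm) hv (rz'.trans hY.symm)
          rw [← hq, ← hev, listEval_letters] at this
          omega
        · -- `z'` represents a permutation, which is moved to the first factor
          obtain ⟨f, hf⟩ := exists_perm_of_rank_eq rz'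
          refine ⟨x ++ letters q, y, g.trans f, by simp, ?_, ?_⟩
          · rw [listEval_append, hq, ← mul_assoc, hu, hf, restr_mul_restr, restr_eq_iff]
            simp
          · have h1 : restr Finset.univ f.symm * restr Finset.univ f = (1 : SymInvMonoid n) := by
              rw [restr_mul_restr, ← restr_univ_one, restr_eq_iff]
              simp
            rw [hf] at hv
            rw [← one_mul (P.listEval y), ← h1, mul_assoc, hv, restr_mul_restr, restr_eq_iff]
            refine ⟨?_, fun _ _ => rfl⟩
            ext i
            simp [Equiv.eq_symm_apply]
      · -- `z` represents a permutation, which is moved to the second factor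
        obtain ⟨f, hf⟩ := exists_perm_of_rank_eq rz
        refine ⟨x, letters q ++ y, g.trans f.symm, by simp, ?_, ?_⟩
        · have h1 : restr Finset.univ f * restr Finset.univ f.symm = (1 : SymInvMonoid n) := by
            rw [restr_mul_restr, ← restr_univ_one, restr_eq_iff]
            simp
          rw [hf] at hu
          rw [← mul_one (P.listEval x), ← h1, ← mul_assoc, hu, restr_mul_restr, restr_eq_iff]
          simp
        · rw [listEval_append, hq, mul_assoc, hv, hf, restr_mul_restr, restr_eq_iff]
          refine ⟨?_, fun _ _ => rfl⟩
          ext i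
          simp [Equiv.symm_apply_eq]
  · -- the relation is applied inside the second factor
    refine ⟨u, z ++ (letters q ++ y), g, by simp, hu, ?_⟩
    simpa only [listEval_append, hev] using hv

/-- Some relation has rank at most `|X ∩ Y|`: without it, the presentation would not imply that
the identities on `X` and on `Y` commute. -/
theorem exists_rel_rank_le (P : SemigroupPresentation (rankIdeal n m)) {X Y : Finset (Fin n)}
    {s : ℕ} (hX : X.card = s) (hY : Y.card = s) (hXY : X ≠ Y) (hsm : s ≤ m)
    (hs : ∀ r, s ≤ r → r ≤ m → r = s ∨ r = n) :
    ∃ p ∈ P.rels, (P.eval p.1).1.rank ≤ (X ∩ Y).card := by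
  by_contra! hP
  have mem {Z : Finset (Fin n)} (hZ : Z.card = s) : restr Z 1 ∈ rankIdeal n m :=
    (rank_restr Z 1).trans_le (hZ.trans_le hsm)
  obtain ⟨u, hu⟩ := P.eval_surjective ⟨restr X 1, mem hX⟩
  obtain ⟨v, hv⟩ := P.eval_surjective ⟨restr Y 1, mem hY⟩
  have hu' : P.listEval (letters u) = restr X 1 := by rw [listEval_letters, hu]
  have hv' : P.listEval (letters v) = restr Y 1 := by rw [listEval_letters, hv]
  have comm : P.eval (u * v) = P.eval (v * u) := by
    rw [eval_mul, eval_mul, hu, hv]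
    refine Subtype.ext ?_
    change restr X 1 * restr Y 1 = restr Y 1 * restr X 1
    rw [restr_mul_restr, restr_mul_restr, restr_eq_iff]
    refine ⟨?_, fun _ _ => rfl⟩
    ext i
    rw [Finset.mem_filter, Finset.mem_filter]
    exact and_comm
  have key := (P.iff_of_eval_eq (SplitsAt P X Y) (fun p hp x y =>
    ⟨SplitsAt.replace hX hY hs (hP p hp) (P.eval_eq_of_mem_rels hp),
      SplitsAt.replace hX hY hs (P.eval_eq_of_mem_rels hp ▸ hP p hp)
        (P.eval_eq_of_mem_rels hp).symm⟩) comm).1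
    ⟨letters u, letters v, 1, letters_mul u v, hu', by
      rw [hv', restr_eq_iff]
      exact ⟨by simp, fun _ _ => rfl⟩⟩
  -- a prefix of the word `v * u` with domain `X` is comparable with its prefix `v`
  obtain ⟨u₁, v₁, g, e, h1, -⟩ := key
  rw [letters_mul, List.append_eq_append_iff] at e
  obtain ⟨z, rfl, -⟩ | ⟨z, hz, -⟩ := e
  · rw [listEval_append, hv'] at h1
    exact hXY (Finset.eq_of_subset_of_card_le (domain_subset_of_mul_eq h1) (by omega))
  · rw [hz, listEval_append, h1] at hv'
    exact hXY (Finset.eq_of_subset_of_card_le (domain_subset_of_mul_eq hv') (by omega)).symm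

/-- The semigroup `I_0` has one element, and the free semigroup on any nonempty alphabet has more
than one. -/
theorem rels_nonempty_of_rank_zero (P : SemigroupPresentation (rankIdeal n 0)) :
    P.rels.Nonempty := by
  by_contra! hP
  obtain ⟨u, -⟩ := P.eval_surjective ⟨restr ∅ 1, (rank_restr ∅ 1).le⟩
  have hsub (s t : rankIdeal n 0) : s = t := by
    have key (s : rankIdeal n 0) : s.1 = restr ∅ 1 := by
      obtain ⟨A, g, h⟩ := exists_eq_restr s.1
      have h1 : s.1.rank ≤ 0 := s.2
      rw [h, rank_restr, Nat.le_zero, Finset.card_eq_zero] at h1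
      rw [h, restr_eq_iff, h1]
      simp
    exact Subtype.ext ((key s).trans (key t).symm)
  have := P.iff_of_eval_eq (fun w => w = letters u) (by simp [hP])
    (hsub (P.eval u) (P.eval (u * u)))
  have h2 := congrArg List.length (this.1 rfl)
  rw [letters_mul, List.length_append] at h2
  simp [letters] at h2

theorem le_relationalDepth_rankIdeal (hmn : m ≤ n) {r : ℕ}
    (h : ∀ P : SemigroupPresentation (rankIdeal n m), ∃ p ∈ P.rels, (P.eval p.1).1.rank ≤ r) :
    ((m + 1 - r : ℕ) : ℕ∞) ≤ relationalDepth (rankIdeal n m) := by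
  refine le_iInf fun P => ?_
  obtain ⟨p, hp, hr⟩ := h P
  refine le_trans ?_ (le_iSup₂ (f := fun p (_ : p ∈ P.rels) => P.wordDepth p.1) p hp)
  rw [wordDepth, elementDepth_rankIdeal hmn]
  exact Nat.cast_le.2 (Nat.sub_le_sub_left hr _)

/-- Two distinct `m`-subsets of an `n`-set can meet in as few as `2 * m - n` points (in none, if
`2 * m ≤ n`). -/
theorem exists_card_inter_eq (hm : 0 < m) (hmn : m < n) : ∃ X Y : Finset (Fin n),
    X.card = m ∧ Y.card = m ∧ X ≠ Y ∧ (X ∩ Y).card = 2 * m - n := by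
  obtain ⟨X, -, hX⟩ := Finset.exists_subset_card_eq (s := (Finset.univ : Finset (Fin n))) (n := m)
    (by simpa using hmn.le)
  have hXc : Xᶜ.card = n - m := by rw [Finset.card_compl, hX, Fintype.card_fin]
  obtain ⟨Y₁, hY₁, hY₁c⟩ := Finset.exists_subset_card_eq (s := Xᶜ) (n := min m (n - m))
    (by rw [hXc]; exact min_le_right _ _)
  obtain ⟨Y₂, hY₂, hY₂c⟩ := Finset.exists_subset_card_eq (s := X) (n := 2 * m - n) (by omega)
  have hd : Disjoint X Y₁ := Finset.disjoint_left.2 fun i hi hi' =>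
    Finset.mem_compl.1 (hY₁ hi') hi
  have hi : X ∩ (Y₁ ∪ Y₂) = Y₂ := by
    rw [Finset.inter_union_distrib_left, Finset.disjoint_iff_inter_eq_empty.1 hd,
      Finset.empty_union, Finset.inter_eq_right.2 hY₂]
  refine ⟨X, Y₁ ∪ Y₂, hX, ?_, ?_, by rw [hi, hY₂c]⟩
  · rw [Finset.card_union_of_disjoint (Finset.disjoint_of_subset_right hY₂ hd.symm), hY₁c, hY₂c]
    omega
  · intro h'
    rw [← h', Finset.inter_self] at hi
    rw [hi] at hX
    omega

end LowerBound

/-! ### The relational depth of the ideals -/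

theorem mainTheorem3 (n m : ℕ) :
    (m = n → 2 ≤ n → relationalDepth (rankIdeal n m) = 3) ∧
    (m < n → n < 2 * m → relationalDepth (rankIdeal n m) = ((n - m + 1 : ℕ) : ℕ∞)) ∧
    (2 * m ≤ n → relationalDepth (rankIdeal n m) = ((m + 1 : ℕ) : ℕ∞)) := by
  have proper (hmn : m < n) :
      relationalDepth (rankIdeal n m) = ((m + 1 - (2 * m - n) : ℕ) : ℕ∞) := by
    refine le_antisymm (relationalDepth_rankIdeal_le n m _ hmn.le (by omega)) ?_
    refine le_relationalDepth_rankIdeal hmn.le fun P => ?_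
    rcases Nat.eq_zero_or_pos m with rfl | hm
    · obtain ⟨p, hp⟩ := rels_nonempty_of_rank_zero P
      exact ⟨p, hp, (P.eval p.1).2.trans (Nat.zero_le _)⟩
    · obtain ⟨X, Y, hX, hY, hXY, hi⟩ := exists_card_inter_eq hm hmn
      rw [← hi]
      exact exists_rel_rank_le P hX hY hXY le_rfl (by omega)
  refine ⟨?_, fun h1 h2 => ?_, fun h => ?_⟩
  · rintro rfl hm
    have h3 : (3 : ℕ∞) = ((m + 1 - (m - 2) : ℕ) : ℕ∞) := by
      rw [show m + 1 - (m - 2) = 3 by omega]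
      rfl
    rw [h3]
    refine le_antisymm (relationalDepth_rankIdeal_le m m _ le_rfl (by omega)) ?_
    refine le_relationalDepth_rankIdeal le_rfl fun P => ?_
    let i : Fin m := ⟨0, by omega⟩
    let j : Fin m := ⟨1, by omega⟩
    have hij : i ≠ j := by simp [i, j]
    have hc (k : Fin m) : ((Finset.univ : Finset (Fin m)).erase k).card = m - 1 := by
      rw [Finset.card_erase_of_mem (Finset.mem_univ k), Finset.card_univ, Fintype.card_fin]
    have hne : (Finset.univ : Finset (Fin m)).erase i ≠ Finset.univ.erase j := fun h => by
      have := Finset.ext_iff.1 h i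
      simp [hij] at this
    have hi : ((Finset.univ : Finset (Fin m)).erase i ∩ Finset.univ.erase j).card = m - 2 := by
      rw [Finset.inter_erase, Finset.inter_univ,
        Finset.card_erase_of_mem (by simp [hij.symm]), hc]
      omega
    rw [← hi]
    exact exists_rel_rank_le P (hc i) (hc j) hne (by omega) (by omega)
  · rw [proper h1]
    congr 1
    omega
  · rcases Nat.eq_zero_or_pos n with rfl | hn
    · obtain rfl : m = 0 := by omega
      refine le_antisymm (relationalDepth_rankIdeal_le 0 0 0 le_rfl (by omega)) ?_
      refine le_relationalDepth_rankIdeal le_rfl (r := 0) fun P => ?_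
      obtain ⟨p, hp⟩ := rels_nonempty_of_rank_zero P
      exact ⟨p, hp, (P.eval p.1).2⟩
    · rw [proper (by omega)]
      congr 1
      omega
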